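/- Let $\Gamma$ be a countable discrete abelian group. By a measure-preserving system $(X,\mathcal B,\mu,(T_g)_{g\in\Gamma})$ we mean a non-atomic Lebesgue probability space $(X,\mathcal B,\mu)$ (that is, a probability space which is isomorphic mod $0$ to a standard Borel space with a non-atomic Borel probability measure) together with an action $(T_g)_{g\in\Gamma}$ of $\Gamma$ on $X$ by measure-preserving transformations. A set $R\subseteq\Gamma$ is a set of recurrence if for every measure-preserving system $(X,\mathcal B,\mu,(T_g)_{g\in\Gamma})$ and every $A\in\mathcal B$ with $\mu(A)>0$ there is an $r\in R\setminus\{0\}$ such that $\mu(A\cap T_r^{-1}A)>0$. For $\delta>0$, a set $R\subseteq\Gamma$ is a set of $\delta$-recurrence if for every measure-preserving system $(X,\mathcal B,\mu,(T_g)_{g\in\Gamma})$ and every $A\in\mathcal B$ with $\mu(A)\ge\delta$ there is an $r\in R\setminus\{0\}$ such that $\mu(A\cap T_r^{-1}A)>0$. **Theorem (Uniformity of recurrence).** A set $R\subseteq\Gamma$ is a set of recurrence if and only if for all $\delta>0$ there is a finite subset $R_\delta\subseteq R$ such that $R_\delta$ is a set of $\delta$-recurrence. -/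

import Mathlib

open MeasureTheory

/-- `f : X → Y` and `g : Y → X` form an isomorphism mod `0` between the measure spaces `(X, μ)` and
`(Y, ν)`: they are inverse to each other up to null sets, and each of them is measurable and measure
preserving with respect to the completed `σ`-algebra of its source (so that it does not matter
whether the two `σ`-algebras are complete). -/
structure IsIsoModZero {X Y : Type*} [MeasurableSpace X] [MeasurableSpace Y]
    (μ : Measure X) (ν : Measure Y) (f : X → Y) (g : Y → X) : Prop where
  nullMeasurable_left : NullMeasurable f μ
  nullMeasurable_right : NullMeasurable g ν
  measure_preimage_left : ∀ s : Set Y, MeasurableSet s → μ (f ⁻¹' s) = ν s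
  measure_preimage_right : ∀ s : Set X, MeasurableSet s → ν (g ⁻¹' s) = μ s
  left_inv : ∀ᵐ x ∂μ, g (f x) = x
  right_inv : ∀ᵐ y ∂ν, f (g y) = y

/-- `(X, μ)` is a non-atomic Lebesgue probability space: it is isomorphic mod `0` to a standard
Borel space with a Borel probability measure that vanishes on points (on a standard Borel space this
is the same as having no atoms). -/
def IsNonatomicLebesgueSpace {X : Type*} [MeasurableSpace X] (μ : Measure X) : Prop :=
  ∃ (Y : Type) (_ : MeasurableSpace Y) (_ : StandardBorelSpace Y) (ν : Measure Y),
    IsProbabilityMeasure ν ∧ NullSingletonClass ν ∧ ∃ (f : X → Y) (g : Y → X), IsIsoModZero μ ν f g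

/-- `(X, μ, (T g)_{g ∈ Γ})` is a measure-preserving system: `(X, μ)` is a non-atomic Lebesgue
probability space and `T` is an action of `Γ` on `X` by measure-preserving transformations. -/
structure IsMeasurePreservingSystem {Γ X : Type*} [AddCommGroup Γ] [MeasurableSpace X]
    (μ : Measure X) (T : Γ → X → X) : Prop where
  isProbabilityMeasure : IsProbabilityMeasure μ
  isNonatomicLebesgueSpace : IsNonatomicLebesgueSpace μ
  map_zero : ∀ x, T 0 x = x
  map_add : ∀ g h x, T (g + h) x = T g (T h x)
  measurePreserving : ∀ g, MeasurePreserving (T g) μ μ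

universe u v

/-- `R` is a set of recurrence (with respect to systems whose underlying set lies in `Type v`). -/
def IsSetOfRecurrence {Γ : Type u} [AddCommGroup Γ] (R : Set Γ) : Prop :=
  ∀ (X : Type v) [MeasurableSpace X] (μ : Measure X) (T : Γ → X → X),
    IsMeasurePreservingSystem μ T → ∀ A : Set X, MeasurableSet A → 0 < μ A →
      ∃ r ∈ R \ {0}, 0 < μ (A ∩ T r ⁻¹' A)

/-- `R` is a set of `δ`-recurrence (with respect to systems whose underlying set lies in
`Type v`). -/
def IsSetOfDeltaRecurrence {Γ : Type u} [AddCommGroup Γ] (δ : ℝ) (R : Set Γ) : Prop :=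
  ∀ (X : Type v) [MeasurableSpace X] (μ : Measure X) (T : Γ → X → X),
    IsMeasurePreservingSystem μ T → ∀ A : Set X, MeasurableSet A → ENNReal.ofReal δ ≤ μ A →
      ∃ r ∈ R \ {0}, 0 < μ (A ∩ T r ⁻¹' A)

open scoped ENNReal unitInterval

/-! The forward direction is a compactness argument. If every finite part of `R` fails for `δ`, each
failure is recorded by the law of the itinerary of `A`, a shift-invariant measure on `Γ → Bool`.
Probability measures on this compact space form a weak-* compact space, and the cylinders involved
are clopen, so invariance, measure at least `δ` and null returns are all closed conditions. A common
solution for all of `R \ {0}` exists; multiplying by the unit interval removes its atoms and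
contradicts recurrence. The converse takes `δ = μ A`. -/

/-- The shift by `h` on the full shift `Γ → Bool`. -/
def boolShift {Γ : Type*} [Add Γ] (h : Γ) (ω : Γ → Bool) : Γ → Bool := fun g ↦ ω (g + h)

section Shift

variable {Γ : Type*} [AddCommGroup Γ]

lemma continuous_boolShift (h : Γ) : Continuous (boolShift h) :=
  continuous_pi fun g ↦ continuous_apply (g + h)

lemma measurable_boolShift (h : Γ) : Measurable (boolShift h) :=
  measurable_pi_lambda _ fun g ↦ measurable_pi_apply (g + h)

lemma boolShift_zero (ω : Γ → Bool) : boolShift 0 ω = ω := by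
  ext g; simp [boolShift]

lemma boolShift_add (g h : Γ) (ω : Γ → Bool) :
    boolShift (g + h) ω = boolShift g (boolShift h ω) := by
  ext k; simp [boolShift, add_assoc]

end Shift

lemma isClopen_setOf_apply_eq_true {ι : Type*} (i : ι) : IsClopen {ω : ι → Bool | ω i = true} :=
  (isClopen_discrete {true}).preimage (continuous_apply i)

/-- The measure of a clopen set depends continuously on the probability measure. -/
lemma IsClopen.continuous_probabilityMeasure_apply {Ω : Type*} [TopologicalSpace Ω]
    [MeasurableSpace Ω] [OpensMeasurableSpace Ω] [HasOuterApproxClosed Ω] {E : Set Ω}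
    (hE : IsClopen E) : Continuous fun ν : ProbabilityMeasure Ω ↦ (ν : Measure Ω) E :=
  continuous_iff_continuousAt.2 fun _ ↦
    ProbabilityMeasure.tendsto_measure_of_null_frontier_of_tendsto' Filter.tendsto_id
      (by simp [hE.frontier_eq])

/-- The symbolic model of a measurable set in a system: its law is a shift-invariant probability
measure on `Γ → Bool` with the same measures of return-time sets. -/
lemma exists_shiftInvariant_of_action {Γ X : Type*} [AddCommGroup Γ] [Countable Γ]
    [MeasurableSpace X] {μ : Measure X} [IsProbabilityMeasure μ] {T : Γ → X → X}
    (T_zero : ∀ x, T 0 x = x) (T_add : ∀ g h x, T (g + h) x = T g (T h x))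
    (hT : ∀ g, MeasurePreserving (T g) μ μ) {A : Set X} (hA : MeasurableSet A) :
    ∃ ν : ProbabilityMeasure (Γ → Bool),
      (∀ h, ν.map (measurable_boolShift h).aemeasurable = ν) ∧
      (ν : Measure (Γ → Bool)) {ω | ω 0 = true} = μ A ∧
      ∀ r, (ν : Measure (Γ → Bool)) ({ω | ω 0 = true} ∩ {ω | ω r = true}) =
        μ (A ∩ T r ⁻¹' A) := by
  classical
  let φ : X → Γ → Bool := fun x g ↦ decide (T g x ∈ A)
  have hφ : Measurable φ := measurable_pi_lambda _ fun g ↦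
    measurable_to_bool (by simpa [φ, Set.preimage] using (hT g).measurable hA)
  have hmeas (g : Γ) : MeasurableSet {ω : Γ → Bool | ω g = true} :=
    (isClopen_setOf_apply_eq_true g).isOpen.measurableSet
  refine ⟨⟨μ.map φ, Measure.isProbabilityMeasure_map hφ.aemeasurable⟩, fun h ↦ ?_, ?_, fun r ↦ ?_⟩
  · apply Subtype.ext
    change (μ.map φ).map (boolShift h) = μ.map φ
    have hcomm : boolShift h ∘ φ = φ ∘ T h := by
      ext x g
      simp [φ, boolShift, T_add]
    rw [Measure.map_map (measurable_boolShift h) hφ, hcomm,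
      ← Measure.map_map hφ (hT h).measurable, (hT h).map_eq]
  · change μ.map φ _ = _
    rw [Measure.map_apply hφ (hmeas 0)]
    simp [φ, T_zero]
  · change μ.map φ _ = _
    rw [Measure.map_apply hφ ((hmeas 0).inter (hmeas r))]
    simp [φ, T_zero, Set.preimage, Set.inter_def]

/-- Compactness: if every finite part of `R` is avoided by the return times of some set of measure
at least `δ` in a shift-invariant measure, then so is all of `R`. -/
lemma exists_shiftInvariant_of_forall_finset {Γ : Type*} [AddCommGroup Γ] [Countable Γ]
    {R : Set Γ} {δ : ℝ≥0∞}
    (h : ∀ F : Finset R, ∃ ν : ProbabilityMeasure (Γ → Bool),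
      (∀ h, ν.map (measurable_boolShift h).aemeasurable = ν) ∧
      δ ≤ (ν : Measure (Γ → Bool)) {ω | ω 0 = true} ∧
      ∀ r ∈ F, (ν : Measure (Γ → Bool)) ({ω | ω 0 = true} ∩ {ω | ω (r : Γ) = true}) = 0) :
    ∃ ν : ProbabilityMeasure (Γ → Bool),
      (∀ h, ν.map (measurable_boolShift h).aemeasurable = ν) ∧
      δ ≤ (ν : Measure (Γ → Bool)) {ω | ω 0 = true} ∧
      ∀ r ∈ R, (ν : Measure (Γ → Bool)) ({ω | ω 0 = true} ∩ {ω | ω r = true}) = 0 := by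
  have hclosed : IsClosed {ν : ProbabilityMeasure (Γ → Bool) |
      (∀ h, ν.map (measurable_boolShift h).aemeasurable = ν) ∧
      δ ≤ (ν : Measure (Γ → Bool)) {ω | ω 0 = true}} := by
    rw [Set.ofPred_and, Set.ofPred_forall]
    exact (isClosed_iInter fun h ↦
      isClosed_eq (ProbabilityMeasure.continuous_map (continuous_boolShift h)) continuous_id).inter
        (isClosed_le continuous_const
          (isClopen_setOf_apply_eq_true 0).continuous_probabilityMeasure_apply)
  -- Finite intersection property, one closed condition per `r ∈ R`.
  obtain ⟨ν, ⟨hinv, hδ⟩, hν⟩ := hclosed.isCompact.inter_iInter_nonempty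
    (fun r : R ↦ {ν : ProbabilityMeasure (Γ → Bool) |
      (ν : Measure (Γ → Bool)) ({ω | ω 0 = true} ∩ {ω | ω (r : Γ) = true}) = 0})
    (fun r ↦ isClosed_eq ((isClopen_setOf_apply_eq_true 0).inter
      (isClopen_setOf_apply_eq_true (r : Γ))).continuous_probabilityMeasure_apply continuous_const)
    (fun F ↦ by
      obtain ⟨ν, hinv, hδ, hν⟩ := h F
      exact ⟨ν, ⟨hinv, hδ⟩, Set.mem_iInter₂.2 hν⟩)
  exact ⟨ν, hinv, hδ, fun r hr ↦ Set.mem_iInter.1 hν ⟨r, hr⟩⟩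

/-- A measurable isomorphism with a standard Borel probability space without point masses makes a
space nonatomic Lebesgue. -/
lemma isNonatomicLebesgueSpace_map {X : Type*} {Y : Type} [MeasurableSpace X] [MeasurableSpace Y]
    [StandardBorelSpace Y] (e : X ≃ᵐ Y) (μ : Measure X) [IsProbabilityMeasure μ]
    [NullSingletonClass μ] : IsNonatomicLebesgueSpace μ := by
  refine ⟨Y, inferInstance, inferInstance, μ.map e,
    Measure.isProbabilityMeasure_map e.measurable.aemeasurable, ⟨fun y ↦ ?_⟩, e, e.symm,
    e.measurable.nullMeasurable, e.symm.measurable.nullMeasurable,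
    fun s _ ↦ (e.map_apply s).symm, fun s _ ↦ ?_, by simp, by simp⟩
  · rw [e.map_apply, ← e.image_symm, Set.image_singleton]
    exact measure_singleton _
  · rw [e.map_apply, ← Set.preimage_comp]
    simp

/-- Every action on a standard Borel probability space has a nonatomic extension, which may be
realised in any universe. -/
lemma exists_isMeasurePreservingSystem_extension {Γ Y : Type*} [AddCommGroup Γ]
    [MeasurableSpace Y] [StandardBorelSpace Y] (ν : Measure Y) [IsProbabilityMeasure ν]
    {S : Γ → Y → Y} (S_zero : ∀ y, S 0 y = y) (S_add : ∀ g h y, S (g + h) y = S g (S h y))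
    (hS : ∀ g, MeasurePreserving (S g) ν ν) :
    ∃ (X : Type v) (_ : MeasurableSpace X) (μ : Measure X) (T : Γ → X → X) (π : X → Y),
      IsMeasurePreservingSystem μ T ∧ MeasurePreserving π μ ν ∧
        ∀ g x, π (T g x) = S g (π x) := by
  -- `ν` may have atoms; the factor `I`, on which `Γ` will act trivially, removes them.
  let ρ : Measure (Y × I) := ν.prod volume
  -- Being uncountable, `Y × I` is Borel isomorphic to Cantor space, which lies in `Type` and lifts
  -- to every universe.
  have hunc : ¬ Countable (Y × I) := fun _ ↦
    one_ne_zero ((measure_univ (μ := ρ)).symm.trans (Set.countable_univ.measure_zero ρ))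
  let f : Y × I ≃ᵐ (ℕ → Bool) := PolishSpace.measurableEquivNatBoolOfNotCountable hunc
  let e : Y × I ≃ᵐ ULift.{v} (ℕ → Bool) := f.trans MeasurableEquiv.ulift.symm
  have he : MeasurePreserving e ρ (ρ.map e) := e.measurable.measurePreserving ρ
  have he' : MeasurePreserving e.symm (ρ.map e) ρ := he.symm e
  have : IsProbabilityMeasure (ρ.map e) :=
    Measure.isProbabilityMeasure_map e.measurable.aemeasurable
  have : NullSingletonClass (ρ.map e) := ⟨fun x ↦ by
    rw [e.map_apply, ← e.image_symm, Set.image_singleton]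
    exact measure_singleton _⟩
  refine ⟨ULift.{v} (ℕ → Bool), inferInstance, ρ.map e,
    fun g x ↦ e (Prod.map (S g) id (e.symm x)), fun x ↦ (e.symm x).1,
    ⟨inferInstance, isNonatomicLebesgueSpace_map MeasurableEquiv.ulift _, fun x ↦ ?_,
      fun g h x ↦ ?_, fun g ↦ ?_⟩, measurePreserving_fst.comp he', fun g x ↦ by simp⟩
  · simp [Prod.map, S_zero]
  · simp [Prod.map, S_add]
  · exact he.comp (((hS g).prod (MeasurePreserving.id volume)).comp he')

theorem mainTheorem9 {Γ : Type u} [AddCommGroup Γ] [Countable Γ] (R : Set Γ) :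
    IsSetOfRecurrence.{u, v} R ↔
      ∀ δ : ℝ, 0 < δ →
        ∃ S : Set Γ, S ⊆ R ∧ S.Finite ∧ IsSetOfDeltaRecurrence.{u, v} δ S := by
  constructor
  · intro hR δ hδ
    by_contra! hcon
    -- Zero is discarded since its return set is all of `A`, never null here.
    have hfin (F : Finset (R \ {0} : Set Γ)) : ∃ ν : ProbabilityMeasure (Γ → Bool),
        (∀ h, ν.map (measurable_boolShift h).aemeasurable = ν) ∧
        ENNReal.ofReal δ ≤ (ν : Measure (Γ → Bool)) {ω | ω 0 = true} ∧
        ∀ r ∈ F, (ν : Measure (Γ → Bool))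
          ({ω | ω 0 = true} ∩ {ω | ω (r : Γ) = true}) = 0 := by
      have hF := hcon (Subtype.val '' (F : Set (R \ {0} : Set Γ)))
        (by rintro _ ⟨r, -, rfl⟩; exact r.2.1) (F.finite_toSet.image _)
      simp only [IsSetOfDeltaRecurrence] at hF
      push Not at hF
      obtain ⟨X, _, μ, T, hT, A, hA, hδA, hrec⟩ := hF
      have := hT.isProbabilityMeasure
      obtain ⟨ν, hinv, h0, hν⟩ := exists_shiftInvariant_of_action hT.map_zero hT.map_add
        hT.measurePreserving hA
      refine ⟨ν, hinv, h0 ▸ hδA, fun r hr ↦ (hν r).trans (le_antisymm (hrec r ⟨?_, r.2.2⟩) zero_le)⟩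
      exact ⟨r, hr, rfl⟩
    obtain ⟨ν, hinv, hδν, hν⟩ := exists_shiftInvariant_of_forall_finset hfin
    obtain ⟨X, _, μ, T, π, hT, hπ, hcomm⟩ := exists_isMeasurePreservingSystem_extension.{v}
      (ν : Measure (Γ → Bool)) boolShift_zero boolShift_add
      fun g ↦ ⟨measurable_boolShift g, congrArg Subtype.val (hinv g)⟩
    have hmeas (g : Γ) : MeasurableSet {ω : Γ → Bool | ω g = true} :=
      (isClopen_setOf_apply_eq_true g).isOpen.measurableSet
    obtain ⟨r, hr, hpos⟩ := hR X μ T hT (π ⁻¹' {ω | ω 0 = true}) (hπ.measurable (hmeas 0)) (by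
      rw [hπ.measure_preimage (hmeas 0).nullMeasurableSet]
      exact (ENNReal.ofReal_pos.2 hδ).trans_le hδν)
    have hset : π ⁻¹' {ω | ω 0 = true} ∩ T r ⁻¹' (π ⁻¹' {ω | ω 0 = true}) =
        π ⁻¹' ({ω | ω 0 = true} ∩ {ω | ω r = true}) := by
      ext x
      simp [hcomm, boolShift]
    rw [hset, hπ.measure_preimage ((hmeas 0).inter (hmeas r)).nullMeasurableSet, hν r hr] at hpos
    exact hpos.false
  · intro h X _ μ T hT A hA hpos
    have := hT.isProbabilityMeasure
    obtain ⟨S, hSR, -, hS⟩ := h (μ A).toReal (ENNReal.toReal_pos hpos.ne' (measure_ne_top μ A))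
    obtain ⟨r, hr, hrpos⟩ := hS X μ T hT A hA (ENNReal.ofReal_toReal (measure_ne_top μ A)).le
    exact ⟨r, ⟨hSR hr.1, hr.2⟩, hrpos⟩
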